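/- Let $G$ be a compact connected Lie group of dimension $g$ acting holomorphically on a (possibly singular) complex projective variety $M$ (reduced and irreducible) of dimension $n\ge g$, and let $L$ be a $G$-linearized holomorphic line bundle on $M$. For $m\ge 0$, $G$ acts linearly on $H^0(M,L^{\otimes m})$; let $\mathbb{N}_G(L)=\{m\ge 0: H^0(M,L^{\otimes m})^G\ne 0\}$, assume $\mathbb{N}_G(L)\neq\{0\}$, and let the $G$-exponent $e_G(L)$ be the greatest common divisor of the elements of $\mathbb{N}_G(L)$. Let $\mu$ be a highest weight of $G$, with associated irreducible finite-dimensional complex representation $V_\mu$ (so that, up to isomorphism, $V_\mu$ is an arbitrary such representation), and for a $G$-linearized line bundle $B$ on $M$ let $H^0(M,B)_\mu$ be the sum of all subrepresentations of $H^0(M,B)$ isomorphic to $V_\mu$, and $$\mathrm{vol}_\mu(B)=\limsup_{k\to+\infty}\frac{(n-g)!}{k^{n-g}}\dim H^0(M,B^{\otimes k})_\mu\in[0,+\infty].$$ Then: (1) for every integer $p\ge 1$ coprime to $e_G(L)$, $\ \mathrm{vol}_\mu(L^{\otimes p})=p^{\,n-g}\,\mathrm{vol}_\mu(L)$; (2)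 for every integer $q\ge 1$, $\ \displaystyle \mathrm{vol}_\mu(L^{\otimes q})=\left(\frac{q}{\gcd(q,e_G(L))}\right)^{n-g}\mathrm{vol}_\mu\big(L^{\otimes \gcd(q,e_G(L))}\big).$ (Both sides may be $+\infty$.) -/

import Mathlib

open Filter Topology LinearAlgebra.Projectivization
open scoped ENNReal Manifold ContDiff TensorProduct MonoidAlgebra

noncomputable section

/-! ### Complex projective space and holomorphic functions on its subsets -/

/-- Complex projective space of dimension `N`. -/
abbrev CProj (N : ℕ) : Type := ℙ ℂ (Fin (N + 1) → ℂ)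

/-- The classical (Euclidean) topology on projective space: the quotient topology from
`ℂ^(N+1) ∖ {0}`. -/
instance CProj.instTopologicalSpace (N : ℕ) : TopologicalSpace (CProj N) :=
  TopologicalSpace.coinduced
    (fun v : {v : Fin (N + 1) → ℂ // v ≠ 0} => Projectivization.mk ℂ v.1 v.2) inferInstance

/-- `f`, a function on a subset `X` of projective space, is holomorphic at `x` in the sense of
reduced complex spaces: near `x` it is the restriction of an ambient holomorphic function. Ambient
functions are written in homogeneous coordinates, that is, pulled back to `ℂ^(N+1) ∖ {0}`. -/
def HolomorphicAt {N : ℕ} {X : Set (CProj N)} (f : X → ℂ) (x : X) : Prop :=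
  ∀ (v : Fin (N + 1) → ℂ) (hv : v ≠ 0), Projectivization.mk ℂ v hv = x.1 →
    ∃ F : (Fin (N + 1) → ℂ) → ℂ, AnalyticAt ℂ F v ∧
      ∀ᶠ w in 𝓝 v, ∀ (hw : w ≠ 0) (hX : Projectivization.mk ℂ w hw ∈ X),
        f ⟨Projectivization.mk ℂ w hw, hX⟩ = F w

/-- Holomorphic functions on (open) subsets `U` of `X`. -/
def HolomorphicOn {N : ℕ} {X : Set (CProj N)} (f : X → ℂ) (U : Set X) : Prop :=
  ∀ x ∈ U, HolomorphicAt f x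

/-- Holomorphic maps: continuous maps which pull back local holomorphic functions to local
holomorphic functions. -/
def HolomorphicMap {N : ℕ} {X : Set (CProj N)} (φ : X → X) : Prop :=
  Continuous φ ∧ ∀ (x : X) (f : X → ℂ), HolomorphicAt f (φ x) → HolomorphicAt (f ∘ φ) x

/-- Closed analytic subsets of `X`: near every point of `X`, the common zero locus of finitely
many holomorphic functions. -/
def IsAnalyticSubset {N : ℕ} {X : Set (CProj N)} (A : Set X) : Prop :=
  ∀ x : X, ∃ U : Set X, IsOpen U ∧ x ∈ U ∧ ∃ (r : ℕ) (f : Fin r → X → ℂ),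
    (∀ i, HolomorphicOn (f i) U) ∧ ∀ y ∈ U, y ∈ A ↔ ∀ i, f i y = 0

/-- A complex projective variety: the zero locus in projective space of a set of homogeneous
polynomials, which is irreducible, i.e. non-empty and not the union of two proper closed analytic
subsets. (By Chow's theorem the closed analytic subsets are the Zariski closed ones.) It may be
singular. -/
structure ProjectiveVariety (N : ℕ) where
  carrier : Set (CProj N)
  algebraic : ∃ S : Set (MvPolynomial (Fin (N + 1)) ℂ),
    (∀ p ∈ S, ∃ d : ℕ, p.IsHomogeneous d) ∧
      carrier = {x | ∀ p ∈ S, MvPolynomial.eval x.rep p = 0}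
  nonempty : carrier.Nonempty
  irreducible : ∀ A B : Set carrier, IsAnalyticSubset A → IsAnalyticSubset B →
    A ∪ B = Set.univ → A = Set.univ ∨ B = Set.univ

instance {N : ℕ} : CoeSort (ProjectiveVariety N) Type := ⟨fun M => M.carrier⟩

/-- The ideal of all polynomials which vanish on (the punctured affine cone over) `M`. -/
def ProjectiveVariety.vanishingIdeal {N : ℕ} (M : ProjectiveVariety N) :
    Ideal (MvPolynomial (Fin (N + 1)) ℂ) where
  carrier := {p | ∀ (v : Fin (N + 1) → ℂ) (hv : v ≠ 0),
    Projectivization.mk ℂ v hv ∈ M.carrier → MvPolynomial.eval v p = 0}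
  add_mem' := fun {p q} hp hq v hv hM => by simp [hp v hv hM, hq v hv hM]
  zero_mem' := fun v hv hM => by simp
  smul_mem' := fun c p hp v hv hM => by simp [hp v hv hM]

/-- `M` has (complex) dimension `n`: its homogeneous coordinate ring has Krull dimension
`n + 1`. -/
def ProjectiveVariety.HasDim {N : ℕ} (M : ProjectiveVariety N) (n : ℕ) : Prop :=
  ringKrullDim (MvPolynomial (Fin (N + 1)) ℂ ⧸ M.vanishingIdeal) = n + 1

/-! ### Closure properties of holomorphic functions -/

section HolomorphicLemmas

variable {N : ℕ} {X : Set (CProj N)}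

theorem HolomorphicAt.const (c : ℂ) (x : X) : HolomorphicAt (fun _ => c) x :=
  fun _ _ _ => ⟨fun _ => c, analyticAt_const, Eventually.of_forall fun _ _ _ => rfl⟩

theorem HolomorphicAt.add {f h : X → ℂ} {x : X} (hf : HolomorphicAt f x)
    (hh : HolomorphicAt h x) : HolomorphicAt (fun y => f y + h y) x := by
  intro v hv hx
  obtain ⟨F, hF, hF'⟩ := hf v hv hx
  obtain ⟨H, hH, hH'⟩ := hh v hv hx
  refine ⟨fun w => F w + H w, hF.add hH, ?_⟩
  filter_upwards [hF', hH'] with w h1 h2 hw hX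
  rw [h1 hw hX, h2 hw hX]

theorem HolomorphicAt.mul {f h : X → ℂ} {x : X} (hf : HolomorphicAt f x)
    (hh : HolomorphicAt h x) : HolomorphicAt (fun y => f y * h y) x := by
  intro v hv hx
  obtain ⟨F, hF, hF'⟩ := hf v hv hx
  obtain ⟨H, hH, hH'⟩ := hh v hv hx
  refine ⟨fun w => F w * H w, hF.mul hH, ?_⟩
  filter_upwards [hF', hH'] with w h1 h2 hw hX
  rw [h1 hw hX, h2 hw hX]

theorem HolomorphicAt.pow {f : X → ℂ} {x : X} (hf : HolomorphicAt f x) (k : ℕ) :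
    HolomorphicAt (fun y => f y ^ k) x := by
  intro v hv hx
  obtain ⟨F, hF, hF'⟩ := hf v hv hx
  refine ⟨fun w => F w ^ k, hF.pow k, ?_⟩
  filter_upwards [hF'] with w h1 hw hX
  rw [h1 hw hX]

theorem HolomorphicAt.congr {f h : X → ℂ} {x : X} (hf : HolomorphicAt f x) {O : Set X}
    (hO : IsOpen O) (hxO : x ∈ O) (hfh : ∀ y ∈ O, f y = h y) : HolomorphicAt h x := by
  intro v hv hx
  obtain ⟨F, hF, hF'⟩ := hf v hv hx
  refine ⟨F, hF, ?_⟩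
  obtain ⟨P, hP, rfl⟩ := isOpen_induced_iff.1 hO
  have hP' : IsOpen ((fun u : {u : Fin (N + 1) → ℂ // u ≠ 0} =>
      Projectivization.mk ℂ u.1 u.2) ⁻¹' P) := isOpen_coinduced.1 hP
  have hQ := (isOpen_ne (x := (0 : Fin (N + 1) → ℂ))).isOpenMap_subtype_val _ hP'
  have hvQ : v ∈ Subtype.val '' ((fun u : {u : Fin (N + 1) → ℂ // u ≠ 0} =>
      Projectivization.mk ℂ u.1 u.2) ⁻¹' P) := by
    refine ⟨⟨v, hv⟩, ?_, rfl⟩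
    change Projectivization.mk ℂ v hv ∈ P
    rw [hx]
    exact hxO
  filter_upwards [hF', hQ.mem_nhds hvQ] with w h1 h2 hw hX
  obtain ⟨⟨u, hu⟩, huP, rfl⟩ := h2
  rw [← h1 hw hX]
  exact (hfh _ huP).symm

end HolomorphicLemmas

/-! ### Actions and linearized line bundles -/

/-- A holomorphic action of the topological group `G` on `M`: jointly continuous, each group
element acting by a holomorphic map. -/
class HolomorphicAction {N : ℕ} (G : Type*) [Group G] [TopologicalSpace G]
    (M : ProjectiveVariety N) [MulAction G M] : Prop where
  continuous_smul : Continuous fun q : G × M => q.1 • q.2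
  holomorphic_smul : ∀ g : G, HolomorphicMap fun x : M => g • x

/-- A `G`-linearized holomorphic line bundle on `M`: a family of complex lines with local frames
over the members of an open cover, related by holomorphic transition functions, and an action of
`G` by linear maps between the fibres which covers the action on `M`, is continuous, and is
holomorphic for each fixed group element. The map of `g` from the fibre at `x` to the fibre at
`y = g • x` is written `act g x y _`. -/
structure LinearizedLineBundle {N : ℕ} (G : Type*) [Group G] [TopologicalSpace G]
    (M : ProjectiveVariety N) [MulAction G M] where
  fiber : M → Type
  [addCommGroup : ∀ x, AddCommGroup (fiber x)]
  [module : ∀ x, Module ℂ (fiber x)]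
  ι : Type
  U : ι → Set M
  isOpen_U : ∀ i, IsOpen (U i)
  cover : ∀ x, ∃ i, x ∈ U i
  /-- The local frame over `U i` (its values outside `U i` are irrelevant). -/
  frame : ι → ∀ x, fiber x
  frame_ne_zero : ∀ i, ∀ x ∈ U i, frame i x ≠ 0
  frame_span : ∀ i, ∀ x ∈ U i, ∀ v : fiber x, ∃ c : ℂ, v = c • frame i x
  transition : ∀ i j, ∃ t : M → ℂ, HolomorphicOn t (U i ∩ U j) ∧
    ∀ x ∈ U i ∩ U j, frame j x = t x • frame i x
  act : ∀ (g : G) (x y : M), g • x = y → (fiber x →ₗ[ℂ] fiber y)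
  act_one : ∀ (x : M) (h : (1 : G) • x = x), act 1 x x h = LinearMap.id
  act_mul : ∀ (g h : G) (x y z : M) (hxy : h • x = y) (hyz : g • y = z)
    (hxz : (g * h) • x = z), act (g * h) x z hxz = act g y z hyz ∘ₗ act h x y hxy
  act_frame : ∀ i j, ∃ a : G → M → ℂ,
    ContinuousOn (fun q : G × M => a q.1 q.2) {q | q.2 ∈ U i ∧ q.1 • q.2 ∈ U j} ∧
    (∀ g, HolomorphicOn (a g) {x | x ∈ U i ∧ g • x ∈ U j}) ∧
    ∀ (g : G) (x y : M) (h : g • x = y), x ∈ U i → y ∈ U j →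
      act g x y h (frame i x) = a g x • frame j y

namespace LinearizedLineBundle

attribute [instance] LinearizedLineBundle.addCommGroup LinearizedLineBundle.module

variable {N : ℕ} {G : Type*} [Group G] [TopologicalSpace G]
  {M : ProjectiveVariety N} [MulAction G M]

theorem frame_unique (L : LinearizedLineBundle G M) {i : L.ι} {x : M} (hx : x ∈ L.U i) {a b : ℂ}
    (h : a • L.frame i x = b • L.frame i x) : a = b :=
  smul_left_injective ℂ (L.frame_ne_zero i x hx) h

/-- The space `H⁰(M, L)` of global holomorphic sections. -/
def sections (L : LinearizedLineBundle G M) : Submodule ℂ (∀ x, L.fiber x) where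
  carrier := {s | ∀ i, ∃ f : M → ℂ, HolomorphicOn f (L.U i) ∧
    ∀ x ∈ L.U i, s x = f x • L.frame i x}
  add_mem' := by
    intro s t hs ht i
    obtain ⟨f, hf, hf'⟩ := hs i
    obtain ⟨h, hh, hh'⟩ := ht i
    refine ⟨fun x => f x + h x, fun x hx => (hf x hx).add (hh x hx), fun x hx => ?_⟩
    simp [hf' x hx, hh' x hx, add_smul]
  zero_mem' := fun i => ⟨fun _ => 0, fun x _ => HolomorphicAt.const 0 x, fun x _ => by simp⟩
  smul_mem' := by
    intro c s hs i
    obtain ⟨f, hf, hf'⟩ := hs i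
    refine ⟨fun x => c * f x, fun x hx => (HolomorphicAt.const c x).mul (hf x hx), fun x hx => ?_⟩
    simp [hf' x hx, mul_smul]

/-- The action of `G` on set-theoretic sections, `(g s)(x) = g (s (g⁻¹ x))`. -/
def sectionAct (L : LinearizedLineBundle G M) (g : G) :
    (∀ x, L.fiber x) →ₗ[ℂ] (∀ x, L.fiber x) where
  toFun s x := L.act g (g⁻¹ • x) x (smul_inv_smul g x) (s (g⁻¹ • x))
  map_add' s t := by ext x; simp
  map_smul' c s := by ext x; simp

theorem act_section_congr (L : LinearizedLineBundle G M) (s : ∀ x, L.fiber x) {g h : G} {x x' y : M}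
    (hgh : g = h) (hxx : x = x') (hx : g • x = y) (hx' : h • x' = y) :
    L.act g x y hx (s x) = L.act h x' y hx' (s x') := by
  subst hgh hxx
  rfl

theorem sectionAct_mem [HolomorphicAction G M] (L : LinearizedLineBundle G M) (g : G)
    {s : ∀ x, L.fiber x} (hs : s ∈ L.sections) : L.sectionAct g s ∈ L.sections := by
  intro j
  choose! f hf using fun x (hx : x ∈ L.U j) => L.frame_span j x hx (L.sectionAct g s x)
  refine ⟨f, fun x hx => ?_, hf⟩
  have hmap := HolomorphicAction.holomorphic_smul (M := M) g⁻¹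
  obtain ⟨i, hi⟩ := L.cover (g⁻¹ • x)
  obtain ⟨u, hu, hu'⟩ := hs i
  obtain ⟨a, -, ha, ha'⟩ := L.act_frame i j
  have key : HolomorphicAt (fun y => u y * a g y) (g⁻¹ • x) :=
    (hu _ hi).mul (ha g _ ⟨hi, by rwa [smul_inv_smul]⟩)
  refine (hmap.2 x _ key).congr (O := L.U j ∩ (fun y : M => g⁻¹ • y) ⁻¹' L.U i)
    ((L.isOpen_U j).inter ((L.isOpen_U i).preimage hmap.1)) ⟨hx, hi⟩ ?_
  rintro y ⟨hyj, hyi⟩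
  apply L.frame_unique hyj
  rw [← hf y hyj]
  change _ = L.act g (g⁻¹ • y) y (smul_inv_smul g y) (s (g⁻¹ • y))
  rw [hu' _ hyi, map_smul, ha' g _ _ (smul_inv_smul g y) hyi hyj, smul_smul]
  rfl

/-- The representation of `G` on `H⁰(M, L)`. -/
def rep [HolomorphicAction G M] (L : LinearizedLineBundle G M) :
    Representation ℂ G L.sections where
  toFun g := (L.sectionAct g).restrict fun _ hs => L.sectionAct_mem g hs
  map_one' := by
    ext s x
    change L.act 1 _ _ _ (s.1 _) = s.1 x
    rw [L.act_section_congr s.1 (h := 1) (x' := x) rfl (by simp) _ (one_smul G x), L.act_one]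
    rfl
  map_mul' g h := by
    ext s x
    change L.act (g * h) _ _ _ (s.1 _) = L.act g _ _ _ (L.act h _ _ _ (s.1 _))
    have hx : (g * h) • (h⁻¹ • g⁻¹ • x) = x := by simp [mul_smul]
    rw [L.act_section_congr s.1 (h := g * h) (x' := h⁻¹ • g⁻¹ • x) rfl
      (by simp [mul_smul]) _ hx,
      L.act_mul g h (h⁻¹ • g⁻¹ • x) (g⁻¹ • x) x (by simp) (by simp) hx]
    rfl

theorem tprod_smul_const {E : Type} [AddCommGroup E] [Module ℂ E] (k : ℕ) (c : ℂ) (e : E) :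
    (PiTensorProduct.tprod ℂ fun _ : Fin k => c • e) =
      c ^ k • PiTensorProduct.tprod ℂ fun _ : Fin k => e := by
  have := (PiTensorProduct.tprod ℂ (s := fun _ : Fin k => E)).map_smul_univ
    (fun _ => c) (fun _ => e)
  simpa using this

/-- The tensor power `L^{⊗k}`, with the diagonal `G`-action. -/
def pow (L : LinearizedLineBundle G M) (k : ℕ) : LinearizedLineBundle G M where
  fiber x := ⨂[ℂ]^k (L.fiber x)
  ι := L.ι
  U := L.U
  isOpen_U := L.isOpen_U
  cover := L.cover
  frame i x := PiTensorProduct.tprod ℂ fun _ => L.frame i x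
  frame_ne_zero := by
    intro i x hx h
    obtain ⟨l, hl⟩ := Module.Projective.exists_dual_eq_one ℂ (L.frame_ne_zero i x hx)
    have h1 := congrArg (PiTensorProduct.lift
      ((MultilinearMap.mkPiAlgebra ℂ (Fin k) ℂ).compLinearMap fun _ => l)) h
    simp [hl] at h1
  frame_span := by
    intro i x hx v
    induction v using PiTensorProduct.induction_on with
    | smul_tprod r m =>
      choose c hc using fun t => L.frame_span i x hx (m t)
      refine ⟨r * ∏ t, c t, ?_⟩
      rw [mul_smul, ← MultilinearMap.map_smul_univ]
      congr 2
      exact funext hc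
    | add a b ha hb =>
      obtain ⟨c, rfl⟩ := ha
      obtain ⟨d, rfl⟩ := hb
      exact ⟨c + d, (add_smul _ _ _).symm⟩
  transition := by
    intro i j
    obtain ⟨t, ht, ht'⟩ := L.transition i j
    refine ⟨fun x => t x ^ k, fun x hx => (ht x hx).pow k, fun x hx => ?_⟩
    rw [ht' x hx, tprod_smul_const]
  act g x y h := PiTensorProduct.map fun _ => L.act g x y h
  act_one x h := by
    rw [L.act_one]
    exact PiTensorProduct.map_id
  act_mul g h x y z hxy hyz hxz := by
    rw [L.act_mul g h x y z hxy hyz hxz]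
    exact PiTensorProduct.map_comp _ _
  act_frame := by
    intro i j
    obtain ⟨a, hc, ha, ha'⟩ := L.act_frame i j
    refine ⟨fun g x => a g x ^ k, hc.pow k, fun g x hx => (ha g x hx).pow k, ?_⟩
    intro g x y h hx hy
    rw [PiTensorProduct.map_tprod, ← tprod_smul_const]
    congr 1
    funext _
    exact ha' g x y h hx hy

/-- The semigroup `{m ≥ 0 : H⁰(M, L^{⊗m})^G ≠ 0}`. -/
def semigroup [HolomorphicAction G M] (L : LinearizedLineBundle G M) : Set ℕ :=
  {m | (L.pow m).rep.invariants ≠ ⊥}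

/-- The `G`-exponent `e_G(L)`: the greatest common divisor of the elements of the semigroup. -/
def exponent [HolomorphicAction G M] (L : LinearizedLineBundle G M) : ℕ :=
  Nat.setGcd L.semigroup

/-- `dim H⁰(M, L)_μ`, the dimension of the isotypical component of type `V_μ` (the sum of all
subrepresentations isomorphic to `V_μ`), as an element of `[0, ∞]`. -/
def isotypicDim [HolomorphicAction G M] (L : LinearizedLineBundle G M) {V : Type*}
    [AddCommGroup V] [Module ℂ V] (μ : Representation ℂ G V) : ℝ≥0∞ :=
  (Cardinal.toENat (Module.rank ℂ
    ((isotypicComponent ℂ[G] L.rep.asModule μ.asModule).restrictScalars ℂ)) : ℕ∞)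

/-- The equivariant volume `vol_μ(L) = limsup_k (n-g)! / k^(n-g) · dim H⁰(M, L^{⊗k})_μ`, as an
element of `[0, ∞]`; to be used for `g ≤ n`. -/
def vol [HolomorphicAction G M] (n g : ℕ) (L : LinearizedLineBundle G M) {V : Type*}
    [AddCommGroup V] [Module ℂ V] (μ : Representation ℂ G V) : ℝ≥0∞ :=
  limsup (fun k : ℕ => ((n - g).factorial : ℝ≥0∞) / (k : ℝ≥0∞) ^ (n - g) *
    (L.pow k).isotypicDim μ) atTop

end LinearizedLineBundle

/-- Continuity of a finite-dimensional representation, through its matrix coefficients. -/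
def Representation.IsContinuous {G V : Type*} [Group G] [TopologicalSpace G] [AddCommGroup V]
    [Module ℂ V] (μ : Representation ℂ G V) : Prop :=
  ∀ (v : V) (l : Module.Dual ℂ V), Continuous fun a : G => l (μ a v)

end

/-!
Multiplication by a nonzero invariant section of `L^{⊗m}` is an equivariant linear map
`H⁰(M, L^{⊗k}) → H⁰(M, L^{⊗(k+m)})`, and it is injective because `M` is irreducible: the zero sets
of two sections whose product vanishes are closed analytic subsets covering `M`, so one of them is
`M` (`PowerMap.mulSection_injective`). Hence `d(k) = dim H⁰(M, L^{⊗k})_μ` satisfies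
`d(k) ≤ d(k + m)` for all `m` in the semigroup of `L` (`isotypicDim_le_of_mem_semigroup`). That
semigroup is closed under addition, for the same reason, so it contains all large multiples of its
greatest common divisor `e`.

The rest is elementary (`limsup_comp_mul_eq_pow_mul_limsup`). If `a` is coprime to `b` and
`u(k) ≤ u(k + jb)` for all large `j`, then each `k` is followed, within bounded distance, by a
multiple `k'` of `a` with `u(k) ≤ u(k')`; as `k' / k → 1`, the upper limit of `u(k) / k^r` is already
attained along the multiples of `a`. For `c = gcd(q, e)` this applies to `u(k) = d(ck)`, with
`a = q / c` and `b = e / c`. This does not require the dimensions to be finite.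

Tensor powers of tensor powers occur: `(L^{⊗q})^{⊗k}` has to be compared with `L^{⊗qk}`. The notion
of a power map `L → L'` of degree `d`, a model of `v ↦ v ⊗ ⋯ ⊗ v`, treats all these bundles on the
same footing; any two powers of `L` of the same degree are related through multiplication by the
section `1` of `L^{⊗0}`.
-/

/-! ### Upper limits of quasi-monotone sequences -/

/-- Call `u` quasi-monotone with step `b` if `u k ≤ u (k + j * b)` for all large `j`. Sampling such
a sequence along the multiples of some `a` coprime to `b` multiplies the `limsup` of its
normalization by `k ^ r` by the factor `a ^ r`. -/
theorem limsup_comp_mul_eq_pow_mul_limsup (u : ℕ → ℝ≥0∞) (F : ℝ≥0∞) (r : ℕ)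
    {a b j₀ : ℕ} (ha : 0 < a) (hab : a.Coprime b)
    (hu : ∀ j ≥ j₀, ∀ k, u k ≤ u (k + j * b)) :
    limsup (fun k : ℕ => F / (k : ℝ≥0∞) ^ r * u (a * k)) atTop =
      (a : ℝ≥0∞) ^ r * limsup (fun k : ℕ => F / (k : ℝ≥0∞) ^ r * u k) atTop := by
  have ha0 : (a : ℝ≥0∞) ^ r ≠ 0 := by simp [ha.ne']
  have hat : (a : ℝ≥0∞) ^ r ≠ ⊤ := ENNReal.pow_ne_top (ENNReal.natCast_ne_top a)
  -- the normalized sequence, whose value at `a * k` carries the extra factor `a ^ (-r)`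
  set w : ℕ → ℝ≥0∞ := fun k => F / (k : ℝ≥0∞) ^ r * u k with hw
  have hsub : (fun k : ℕ => F / (k : ℝ≥0∞) ^ r * u (a * k)) =
      fun k => (a : ℝ≥0∞) ^ r * w (a * k) := by
    funext k
    simp only [hw, Nat.cast_mul, mul_pow, div_eq_mul_inv]
    rw [ENNReal.mul_inv (Or.inl ha0) (Or.inl hat)]
    calc F * ((k : ℝ≥0∞) ^ r)⁻¹ * u (a * k)
        = ((a : ℝ≥0∞) ^ r * ((a : ℝ≥0∞) ^ r)⁻¹) * (F * ((k : ℝ≥0∞) ^ r)⁻¹ * u (a * k)) := by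
          rw [ENNReal.mul_inv_cancel ha0 hat, one_mul]
      _ = _ := by ring
  rw [hsub, ENNReal.limsup_const_mul_of_ne_top hat]
  congr 1
  have hmul : Tendsto (fun k => a * k) atTop atTop := tendsto_id.const_mul_atTop' ha
  refine le_antisymm ?_ ?_
  · exact (limsup_comp w (fun k => a * k) atTop).trans_le (limsup_le_limsup_of_le hmul)
  -- every `k` is followed, within bounded distance, by a multiple of `a` reachable by steps of `b`
  have hstep : ∀ k, ∃ m, k ≤ a * m ∧ a * m ≤ k + (j₀ + a) * b ∧ u k ≤ u (a * m) := by
    intro k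
    obtain ⟨i, hi, hi'⟩ : ∃ i < a, a ∣ k + (j₀ + i) * b := by
      have : NeZero a := ⟨ha.ne'⟩
      let z : ZMod a := -(k : ZMod a) * (b : ZMod a)⁻¹ - j₀
      refine ⟨z.val, z.val_lt, ?_⟩
      rw [← ZMod.natCast_eq_zero_iff]
      have hb : (b : ZMod a) * (b : ZMod a)⁻¹ = 1 := ZMod.coe_mul_inv_eq_one b hab.symm
      push_cast
      rw [ZMod.natCast_zmod_val]
      linear_combination (-(k : ZMod a)) * hb
    obtain ⟨m, hm⟩ := hi'
    exact ⟨m, by rw [← hm]; omega, by rw [← hm]; gcongr, hm ▸ hu _ (by omega) k⟩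
  choose m hkm hmk hum using hstep
  -- the cost of passing from `k` to `a * m k` is a factor tending to `1`
  have hm_top : Tendsto m atTop atTop := by
    refine tendsto_atTop.2 fun c => ?_
    filter_upwards [eventually_ge_atTop (a * c)] with k hk
    exact Nat.le_of_mul_le_mul_left (hk.trans (hkm k)) ha
  set v : ℕ → ℝ≥0∞ := fun k => (1 + ((j₀ + a) * b : ℕ) / (k : ℝ≥0∞)) ^ r with hv
  have hv1 : limsup v atTop = 1 := by
    have h0 : Tendsto (fun k : ℕ => (((j₀ + a) * b : ℕ) : ℝ≥0∞) / (k : ℝ≥0∞)) atTop (𝓝 0) := by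
      have := ENNReal.Tendsto.const_div (a := (((j₀ + a) * b : ℕ) : ℝ≥0∞))
        ENNReal.tendsto_nat_nhds_top (Or.inr (ENNReal.natCast_ne_top _))
      simpa using this
    have h1 : Tendsto v atTop (𝓝 ((1 + 0) ^ r)) := ENNReal.Tendsto.pow (tendsto_const_nhds.add h0)
    simpa using h1.limsup_eq
  calc limsup w atTop ≤ limsup (v * fun k => w (a * m k)) atTop := by
        refine limsup_le_limsup ?_
        filter_upwards [eventually_gt_atTop 0] with k hk
        have hk0 : (k : ℝ≥0∞) ≠ 0 := by simpa using hk.ne'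
        have hkt : (k : ℝ≥0∞) ≠ ⊤ := ENNReal.natCast_ne_top k
        have hc0 : ((a * m k : ℕ) : ℝ≥0∞) ≠ 0 := by
          have := hk.trans_le (hkm k)
          exact_mod_cast this.ne'
        have hct : ((a * m k : ℕ) : ℝ≥0∞) ≠ ⊤ := ENNReal.natCast_ne_top _
        have h1 : ((a * m k : ℕ) : ℝ≥0∞) / k ≤ 1 + ((j₀ + a) * b : ℕ) / (k : ℝ≥0∞) := by
          rw [ENNReal.div_le_iff hk0 hkt, add_mul, ENNReal.div_mul_cancel hk0 hkt, one_mul]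
          exact_mod_cast hmk k
        have h2 : F / (k : ℝ≥0∞) ^ r =
            (((a * m k : ℕ) : ℝ≥0∞) / k) ^ r * (F / ((a * m k : ℕ) : ℝ≥0∞) ^ r) := by
          simp only [div_eq_mul_inv, mul_pow, ENNReal.inv_pow]
          calc F * ((k : ℝ≥0∞)⁻¹) ^ r
              = (((a * m k : ℕ) : ℝ≥0∞) * ((a * m k : ℕ) : ℝ≥0∞)⁻¹) ^ r
                * (F * ((k : ℝ≥0∞)⁻¹) ^ r) := by
                rw [ENNReal.mul_inv_cancel hc0 hct, one_pow, one_mul]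
            _ = _ := by rw [mul_pow]; ring
        change F / (k : ℝ≥0∞) ^ r * u k ≤ v k * (F / ((a * m k : ℕ) : ℝ≥0∞) ^ r * u (a * m k))
        rw [h2, mul_assoc]
        exact mul_le_mul' (pow_le_pow_left' h1 r) (mul_le_mul' le_rfl (hum k))
    _ ≤ limsup v atTop * limsup (fun k => w (a * m k)) atTop :=
        ENNReal.limsup_mul_le' (by simp [hv1]) (by simp [hv1])
    _ = limsup ((fun k => w (a * k)) ∘ m) atTop := by rw [hv1, one_mul]; rfl
    _ ≤ limsup (fun k => w (a * k)) atTop :=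
        (limsup_comp _ _ _).trans_le (limsup_le_limsup_of_le hm_top)

/-! ### Isotypical components under injective maps -/

/-- An injective homomorphism of representations does not decrease the rank of isotypical
components. -/
theorem Representation.rank_isotypicComponent_le {G V : Type*} [Group G]
    [AddCommGroup V] [Module ℂ V] {W₁ W₂ : Type} [AddCommGroup W₁] [Module ℂ W₁]
    [AddCommGroup W₂] [Module ℂ W₂]
    {ρ₁ : Representation ℂ G W₁} {ρ₂ : Representation ℂ G W₂} (μ : Representation ℂ G V)
    (hμ : μ.IsIrreducible) (f : W₁ →ₗ[ℂ] W₂) (hf : Function.Injective f)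
    (hfρ : ∀ g s, f (ρ₁ g s) = ρ₂ g (f s)) :
    Module.rank ℂ ((isotypicComponent ℂ[G] ρ₁.asModule μ.asModule).restrictScalars ℂ) ≤
      Module.rank ℂ ((isotypicComponent ℂ[G] ρ₂.asModule μ.asModule).restrictScalars ℂ) := by
  have : IsSimpleModule ℂ[G] μ.asModule := inferInstance
  let F : ρ₁.asModule →ₗ[ℂ[G]] ρ₂.asModule := Representation.IntertwiningMap.equivLinearMapAsModule
    ρ₁ ρ₂ ⟨f, fun g => LinearMap.ext (hfρ g)⟩
  have hF : ∀ w ∈ (isotypicComponent ℂ[G] ρ₁.asModule μ.asModule).restrictScalars ℂ,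
      F.restrictScalars ℂ w ∈
        (isotypicComponent ℂ[G] ρ₂.asModule μ.asModule).restrictScalars ℂ :=
    fun w hw => LinearMap.le_comap_isotypicComponent μ.asModule F hw
  refine LinearMap.rank_le_of_injective ((F.restrictScalars ℂ).restrict hF) fun x y hxy => ?_
  exact Subtype.ext (hf (congrArg Subtype.val hxy))

/-! ### Powers of a line bundle and their multiplication -/

namespace LinearizedLineBundle

variable {N : ℕ} {G : Type*} [Group G] [TopologicalSpace G]
  {M : ProjectiveVariety N} [MulAction G M]

/-- `PowerMap L L' d` exhibits the linearized line bundle `L'` as a `d`-th power of `L`, through an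
equivariant map of the total spaces, homogeneous of degree `d` on the fibers (`v ↦ v ⊗ ⋯ ⊗ v` in the
case of `L^{⊗d}`), which carries the local frames of `L` to those of `L'`. -/
structure PowerMap (L L' : LinearizedLineBundle G M) (d : ℕ) where
  toFun : ∀ x, L.fiber x → L'.fiber x
  map_smul : ∀ x (c : ℂ) v, toFun x (c • v) = c ^ d • toFun x v
  map_act : ∀ g x y h v, toFun y (L.act g x y h v) = L'.act g x y h (toFun x v)
  idx : L.ι → L'.ι
  idx_surjective : Function.Surjective idx
  U_idx : ∀ i, L'.U (idx i) = L.U i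
  frame_idx : ∀ i x, L'.frame (idx i) x = toFun x (L.frame i x)

namespace PowerMap

/-- A line bundle is its own first power. -/
def refl (L : LinearizedLineBundle G M) : PowerMap L L 1 where
  toFun _ v := v
  map_smul _ _ _ := by rw [pow_one]
  map_act _ _ _ _ _ := rfl
  idx := id
  idx_surjective := Function.surjective_id
  U_idx _ := rfl
  frame_idx _ _ := rfl

/-- The tensor power `L^{⊗k}` is a `k`-th power of `L`, through `v ↦ v ⊗ ⋯ ⊗ v`. -/
def tensorPower (L : LinearizedLineBundle G M) (k : ℕ) : PowerMap L (L.pow k) k where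
  toFun _ v := PiTensorProduct.tprod ℂ fun _ : Fin k => v
  map_smul _ c v := tprod_smul_const k c v
  map_act _ _ _ _ _ := (PiTensorProduct.map_tprod _ _).symm
  idx := id
  idx_surjective := Function.surjective_id
  U_idx _ := rfl
  frame_idx _ _ := rfl

/-- A power of a power is a power, of the product degree. -/
def comp {L L' L'' : LinearizedLineBundle G M} {d k : ℕ} (F : PowerMap L L' d)
    (F' : PowerMap L' L'' k) : PowerMap L L'' (d * k) where
  toFun x v := F'.toFun x (F.toFun x v)
  map_smul _ _ _ := by rw [F.map_smul, F'.map_smul, pow_mul]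
  map_act _ _ _ _ _ := by rw [F.map_act, F'.map_act]
  idx i := F'.idx (F.idx i)
  idx_surjective := F'.idx_surjective.comp F.idx_surjective
  U_idx _ := by rw [F'.U_idx, F.U_idx]
  frame_idx _ _ := by rw [F'.frame_idx, F.frame_idx]

variable {L L₁ L₂ L₃ : LinearizedLineBundle G M} {a b c : ℕ}

theorem toFun_frame_ne_zero (F : PowerMap L L₁ a) {i : L.ι} {x : M} (hx : x ∈ L.U i) :
    F.toFun x (L.frame i x) ≠ 0 := by
  rw [← F.frame_idx]
  exact L₁.frame_ne_zero _ x (by rwa [F.U_idx])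

theorem exists_eq_smul (F : PowerMap L L₁ a) {i : L.ι} {x : M} (hx : x ∈ L.U i)
    (w : L₁.fiber x) : ∃ z : ℂ, w = z • F.toFun x (L.frame i x) := by
  rw [← F.frame_idx]
  exact L₁.frame_span _ x (by rwa [F.U_idx]) w

/-- The fiberwise multiplication `L^{⊗a} × L^{⊗b} → L^{⊗(a+b)}`, characterized by its values
`v^a * v^b = v^(a+b)`; it exists because the fibers are lines. -/
theorem exists_pairing (F₁ : PowerMap L L₁ a) (F₂ : PowerMap L L₂ b) (F₃ : PowerMap L L₃ c)
    (h : a + b = c) (x : M) : ∃ β : L₁.fiber x →ₗ[ℂ] L₂.fiber x →ₗ[ℂ] L₃.fiber x,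
      ∀ v, β (F₁.toFun x v) (F₂.toFun x v) = F₃.toFun x v := by
  obtain ⟨i, hi⟩ := L.cover x
  obtain ⟨l₁, h₁⟩ := Module.Projective.exists_dual_eq_one ℂ (F₁.toFun_frame_ne_zero hi)
  obtain ⟨l₂, h₂⟩ := Module.Projective.exists_dual_eq_one ℂ (F₂.toFun_frame_ne_zero hi)
  refine ⟨LinearMap.mk₂ ℂ (fun u w => (l₁ u * l₂ w) • F₃.toFun x (L.frame i x))
    (fun _ _ _ => by simp [add_mul, add_smul]) (fun _ _ _ => by simp [mul_assoc, mul_smul])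
    (fun _ _ _ => by simp [mul_add, add_smul])
    (fun _ _ _ => by simp [mul_left_comm, mul_smul]), fun v => ?_⟩
  obtain ⟨z, rfl⟩ := L.frame_span i x hi v
  simp [F₁.map_smul, F₂.map_smul, F₃.map_smul, h₁, h₂, ← h, pow_add, smul_smul, mul_comm]

/-- The fiberwise multiplication `L^{⊗a} × L^{⊗b} → L^{⊗(a+b)}`, determined by `pairing_toFun`. -/
noncomputable def pairing (F₁ : PowerMap L L₁ a) (F₂ : PowerMap L L₂ b) (F₃ : PowerMap L L₃ c)
    (h : a + b = c) (x : M) : L₁.fiber x →ₗ[ℂ] L₂.fiber x →ₗ[ℂ] L₃.fiber x :=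
  (exists_pairing F₁ F₂ F₃ h x).choose

variable (F₁ : PowerMap L L₁ a) (F₂ : PowerMap L L₂ b) (F₃ : PowerMap L L₃ c) (h : a + b = c)

theorem pairing_toFun (x : M) (v : L.fiber x) :
    pairing F₁ F₂ F₃ h x (F₁.toFun x v) (F₂.toFun x v) = F₃.toFun x v :=
  (exists_pairing F₁ F₂ F₃ h x).choose_spec v

theorem pairing_eq_zero {x : M} {u : L₁.fiber x} {w : L₂.fiber x}
    (huw : pairing F₁ F₂ F₃ h x u w = 0) : u = 0 ∨ w = 0 := by
  obtain ⟨i, hi⟩ := L.cover x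
  obtain ⟨y, rfl⟩ := F₁.exists_eq_smul hi u
  obtain ⟨z, rfl⟩ := F₂.exists_eq_smul hi w
  simp only [_root_.map_smul, LinearMap.smul_apply, pairing_toFun, smul_eq_zero,
    F₃.toFun_frame_ne_zero hi, or_false] at huw
  rcases huw with rfl | rfl <;> simp

theorem act_pairing (g : G) (x y : M) (hxy : g • x = y) (u : L₁.fiber x) (w : L₂.fiber x) :
    L₃.act g x y hxy (pairing F₁ F₂ F₃ h x u w) =
      pairing F₁ F₂ F₃ h y (L₁.act g x y hxy u) (L₂.act g x y hxy w) := by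
  obtain ⟨i, hi⟩ := L.cover x
  obtain ⟨p, rfl⟩ := F₁.exists_eq_smul hi u
  obtain ⟨q, rfl⟩ := F₂.exists_eq_smul hi w
  simp only [_root_.map_smul, LinearMap.smul_apply, pairing_toFun, ← map_act]

theorem pairing_mem_sections {t : ∀ x, L₁.fiber x} (ht : t ∈ L₁.sections)
    {s : ∀ x, L₂.fiber x} (hs : s ∈ L₂.sections) :
    (fun x => pairing F₁ F₂ F₃ h x (t x) (s x)) ∈ L₃.sections := by
  intro j
  obtain ⟨i, rfl⟩ := F₃.idx_surjective j
  obtain ⟨p, hp, hp'⟩ := ht (F₁.idx i)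
  obtain ⟨q, hq, hq'⟩ := hs (F₂.idx i)
  rw [F₁.U_idx] at hp hp'
  rw [F₂.U_idx] at hq hq'
  rw [F₃.U_idx]
  refine ⟨fun x => q x * p x, fun x hx => (hq x hx).mul (hp x hx), fun x hx => ?_⟩
  beta_reduce
  rw [hp' x hx, hq' x hx, F₁.frame_idx, F₂.frame_idx, F₃.frame_idx]
  simp [pairing_toFun, mul_smul]

end PowerMap

/-! ### Multiplication of sections -/

/-- The zero set of a holomorphic section is analytic: in a local frame it is the zero set of one
holomorphic function. -/
theorem isAnalyticSubset_zeros (L : LinearizedLineBundle G M) {s : ∀ x, L.fiber x}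
    (hs : s ∈ L.sections) : IsAnalyticSubset {x | s x = 0} := by
  intro x
  obtain ⟨i, hi⟩ := L.cover x
  obtain ⟨f, hf, hf'⟩ := hs i
  refine ⟨L.U i, L.isOpen_U i, hi, 1, fun _ => f, fun _ => hf, fun y hy => ?_⟩
  simp [hf' y hy, L.frame_ne_zero i y hy]

namespace PowerMap

variable {L L₁ L₂ L₃ : LinearizedLineBundle G M} {a b c : ℕ}
variable (F₁ : PowerMap L L₁ a) (F₂ : PowerMap L L₂ b) (F₃ : PowerMap L L₃ c) (h : a + b = c)

/-- The multiplication `H⁰(M, L^{⊗a}) → H⁰(M, L^{⊗(a+b)})` by a section of `L^{⊗b}`. -/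
noncomputable def mulSection (s : L₂.sections) : L₁.sections →ₗ[ℂ] L₃.sections where
  toFun t := ⟨fun x => pairing F₁ F₂ F₃ h x (t.1 x) (s.1 x),
    pairing_mem_sections F₁ F₂ F₃ h t.2 s.2⟩
  map_add' t t' := by ext x; simp
  map_smul' z t := by ext x; simp

/-- Since `M` is irreducible, a product of nonzero sections is nonzero. -/
theorem mulSection_injective {s : L₂.sections} (hs : s ≠ 0) :
    Function.Injective (mulSection F₁ F₂ F₃ h s) := by
  rw [← LinearMap.ker_eq_bot, LinearMap.ker_eq_bot']
  intro t ht
  have hzero : {x | t.1 x = 0} ∪ {x | s.1 x = 0} = Set.univ :=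
    Set.eq_univ_of_forall fun x =>
      pairing_eq_zero F₁ F₂ F₃ h (congrFun (congrArg Subtype.val ht) x)
  rcases M.irreducible _ _ (L₁.isAnalyticSubset_zeros t.2) (L₂.isAnalyticSubset_zeros s.2) hzero
    with h0 | h0
  · exact Subtype.ext (funext (Set.eq_univ_iff_forall.1 h0))
  · exact absurd (Subtype.ext (funext (Set.eq_univ_iff_forall.1 h0))) hs

theorem mulSection_rep [HolomorphicAction G M] {s : L₂.sections} (hs : s ∈ L₂.rep.invariants)
    (g : G) (t : L₁.sections) :
    mulSection F₁ F₂ F₃ h s (L₁.rep g t) = L₃.rep g (mulSection F₁ F₂ F₃ h s t) := by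
  conv_lhs => rw [← hs g]
  ext x
  exact (act_pairing F₁ F₂ F₃ h g _ x (smul_inv_smul g x) _ _).symm

end PowerMap

/-! ### The semigroup of invariant sections and the volume -/

variable [HolomorphicAction G M]

/-- Multiplication by a nonzero invariant section of `L^{⊗m}` embeds `H⁰(M, L^{⊗a})` equivariantly
into `H⁰(M, L^{⊗(a+m)})`. -/
theorem isotypicDim_le_of_mem_semigroup {L L₁ L₂ : LinearizedLineBundle G M} {a c m : ℕ}
    (F₁ : PowerMap L L₁ a) (F₂ : PowerMap L L₂ c) (hm : m ∈ L.semigroup) (h : a + m = c)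
    {V : Type*} [AddCommGroup V] [Module ℂ V] (μ : Representation ℂ G V) (hμ : μ.IsIrreducible) :
    L₁.isotypicDim μ ≤ L₂.isotypicDim μ := by
  obtain ⟨s, hs, hs0⟩ := Submodule.exists_mem_ne_zero_of_ne_bot hm
  have := Cardinal.toENat.monotone' (Representation.rank_isotypicComponent_le μ hμ
    (PowerMap.mulSection F₁ (PowerMap.tensorPower L m) F₂ h s)
    (PowerMap.mulSection_injective _ _ _ h hs0) (PowerMap.mulSection_rep _ _ _ h hs))
  exact ENat.toENNReal_mono this

theorem add_mem_semigroup (L : LinearizedLineBundle G M) {a b : ℕ} (ha : a ∈ L.semigroup)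
    (hb : b ∈ L.semigroup) : a + b ∈ L.semigroup := by
  obtain ⟨t, ht, ht0⟩ := Submodule.exists_mem_ne_zero_of_ne_bot ha
  obtain ⟨s, hs, hs0⟩ := Submodule.exists_mem_ne_zero_of_ne_bot hb
  let F := PowerMap.tensorPower L
  refine (Submodule.ne_bot_iff _).2 ⟨PowerMap.mulSection (F a) (F b) (F (a + b)) rfl s t, ?_, ?_⟩
  · intro g
    rw [← PowerMap.mulSection_rep _ _ _ rfl hs, ht g]
  · rw [Ne, map_eq_zero_iff _ (PowerMap.mulSection_injective _ _ _ rfl hs0)]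
    exact ht0

/-- The section `1` of the trivial bundle `L^{⊗0}` is invariant. -/
theorem zero_mem_semigroup (L : LinearizedLineBundle G M) : 0 ∈ L.semigroup := by
  let s : (L.pow 0).sections := ⟨fun x => PiTensorProduct.tprod ℂ fun _ : Fin 0 => 0, fun i =>
    ⟨fun _ => 1, fun x _ => HolomorphicAt.const 1 x, fun x _ => by
      rw [one_smul]
      exact congrArg (PiTensorProduct.tprod ℂ) (Subsingleton.elim _ _)⟩⟩
  refine (Submodule.ne_bot_iff _).2 ⟨s, fun g => ?_, fun hs => ?_⟩
  · ext x
    refine (PiTensorProduct.map_tprod _ _).trans ?_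
    exact congrArg (PiTensorProduct.tprod ℂ) (Subsingleton.elim _ _)
  · obtain ⟨x, hx⟩ := M.nonempty
    obtain ⟨i, hi⟩ := L.cover ⟨x, hx⟩
    refine (L.pow 0).frame_ne_zero i _ hi ?_
    refine Eq.trans ?_ (congrFun (congrArg Subtype.val hs) ⟨x, hx⟩)
    exact congrArg (PiTensorProduct.tprod ℂ) (Subsingleton.elim _ _)

/-- The semigroup contains all sufficiently large multiples of the exponent, as does every submonoid of
`ℕ` with respect to its greatest common divisor. -/
theorem exists_forall_mul_exponent_mem_semigroup (L : LinearizedLineBundle G M)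
    (hL : L.semigroup ≠ {0}) :
    ∃ j₀, ∀ j ≥ j₀, j * L.exponent ∈ L.semigroup := by
  have he : 0 < L.exponent := by
    refine Nat.pos_of_ne_zero fun h0 => hL ?_
    exact (Nat.setGcd_eq_zero_iff.1 h0).antisymm
      (Set.singleton_subset_iff.2 L.zero_mem_semigroup)
  let S : AddSubmonoid ℕ :=
    { carrier := L.semigroup
      add_mem' := L.add_mem_semigroup
      zero_mem' := L.zero_mem_semigroup }
  obtain ⟨j₀, hj₀⟩ := Nat.exists_mem_closure_of_ge L.semigroup
  refine ⟨j₀, fun j hj => ?_⟩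
  have hmem := hj₀ (j * L.exponent) (hj.trans (Nat.le_mul_of_pos_right j he)) (dvd_mul_left _ _)
  exact (AddSubmonoid.closure_le (S := S)).2 (fun _ => id) hmem

/-- The volume of any `d`-th power `L'` of `L`, in terms of the tensor powers of `L`: both
`L'^{⊗k}` and `L^{⊗dk}` are powers of `L` of degree `dk`, and multiplication by the invariant
section `1` of `L^{⊗0}` compares them in both directions. -/
theorem vol_eq_limsup {L L' : LinearizedLineBundle G M} {d : ℕ} (F : PowerMap L L' d) (n g : ℕ)
    {V : Type*} [AddCommGroup V] [Module ℂ V] (μ : Representation ℂ G V) (hμ : μ.IsIrreducible) :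
    L'.vol n g μ = limsup (fun k : ℕ => ((n - g).factorial : ℝ≥0∞) / (k : ℝ≥0∞) ^ (n - g) *
      (L.pow (d * k)).isotypicDim μ) atTop := by
  have hdim : ∀ k, (L'.pow k).isotypicDim μ = (L.pow (d * k)).isotypicDim μ := fun k =>
    (isotypicDim_le_of_mem_semigroup (F.comp (PowerMap.tensorPower L' k))
      (PowerMap.tensorPower L (d * k)) L.zero_mem_semigroup rfl μ hμ).antisymm
    (isotypicDim_le_of_mem_semigroup (PowerMap.tensorPower L (d * k))
      (F.comp (PowerMap.tensorPower L' k)) L.zero_mem_semigroup rfl μ hμ)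
  simp only [vol, hdim]

/-- Both homogeneity statements at once: with `d = gcd(q, e)`, the bundle `L'` is `L` itself when
`q` is coprime to the exponent `e`, and `L^{⊗d}` in general. Multiplication by invariant sections
makes `k ↦ dim H⁰(M, L^{⊗dk})_μ` quasi-monotone with step `e / d`, which is coprime to `q / d`. -/
theorem vol_pow_eq (L : LinearizedLineBundle G M) (hL : L.semigroup ≠ {0})
    {L' : LinearizedLineBundle G M} {d q : ℕ} (F : PowerMap L L' d) (hq : 1 ≤ q)
    (hd : q.gcd L.exponent = d) (n g : ℕ)
    {V : Type*} [AddCommGroup V] [Module ℂ V] (μ : Representation ℂ G V) (hμ : μ.IsIrreducible) :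
    (L.pow q).vol n g μ = ((q / d : ℕ) : ℝ≥0∞) ^ (n - g) * L'.vol n g μ := by
  obtain ⟨j₀, hj₀⟩ := L.exists_forall_mul_exponent_mem_semigroup hL
  have hd0 : 0 < d := hd ▸ Nat.gcd_pos_of_pos_left _ hq
  have hdq : d ∣ q := hd ▸ Nat.gcd_dvd_left _ _
  have hde : d ∣ L.exponent := hd ▸ Nat.gcd_dvd_right _ _
  have key := limsup_comp_mul_eq_pow_mul_limsup (fun k => (L.pow (d * k)).isotypicDim μ)
    (n - g).factorial (n - g) (a := q / d) (b := L.exponent / d) (j₀ := j₀)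
    (Nat.div_pos (Nat.le_of_dvd hq hdq) hd0)
    (by subst hd; exact Nat.coprime_div_gcd_div_gcd hd0) fun j hj k =>
      isotypicDim_le_of_mem_semigroup (PowerMap.tensorPower L _) (PowerMap.tensorPower L _)
        (hj₀ j hj) (by rw [mul_add, mul_left_comm, Nat.mul_div_cancel' hde]) μ hμ
  rw [vol_eq_limsup (PowerMap.tensorPower L q) n g μ hμ, vol_eq_limsup F n g μ hμ, ← key]
  simp only [← mul_assoc, Nat.mul_div_cancel' hdq]

end LinearizedLineBundle

theorem mainTheorem5 {N n g : ℕ} (M : ProjectiveVariety N) (hn : M.HasDim n)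
    (G : Type*) [Group G] [TopologicalSpace G] [ChartedSpace (EuclideanSpace ℝ (Fin g)) G]
    [LieGroup (𝓡 g) ∞ G] [CompactSpace G] [ConnectedSpace G]
    [MulAction G M] [HolomorphicAction G M] (hgn : g ≤ n)
    (L : LinearizedLineBundle G M) (hL : L.semigroup ≠ {0})
    {V : Type*} [AddCommGroup V] [Module ℂ V] [FiniteDimensional ℂ V]
    (μ : Representation ℂ G V) (hμ : μ.IsContinuous) (hirr : μ.IsIrreducible) :
    (∀ p : ℕ, 1 ≤ p → Nat.Coprime p L.exponent →
      (L.pow p).vol n g μ = (p : ℝ≥0∞) ^ (n - g) * L.vol n g μ) ∧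
    (∀ q : ℕ, 1 ≤ q →
      (L.pow q).vol n g μ = ((q / Nat.gcd q L.exponent : ℕ) : ℝ≥0∞) ^ (n - g) *
        (L.pow (Nat.gcd q L.exponent)).vol n g μ) := by
  refine ⟨fun p hp hpe => ?_, fun q hq => ?_⟩
  · simpa using L.vol_pow_eq hL (LinearizedLineBundle.PowerMap.refl L) hp hpe n g μ hirr
  · exact L.vol_pow_eq hL (LinearizedLineBundle.PowerMap.tensorPower L _) hq rfl n g μ hirr
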